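/- Let $k$ be an infinite field, let $S=k[x_0,\dots,x_n]$ with homogeneous maximal ideal $\mathfrak m=(x_0,\dots,x_n)$, let $W\subset S$ be an $(r+1)$-dimensional $k$-vector space ($r\ge 0$) of forms of the same degree $d$, and let $I\subset S$ be the ideal generated by $W$. Assume that $I$ has codimension at least $2$. Let $\ell(I)$ denote the analytic spread of $I$, that is, the Krull dimension of the special fiber ring $S[It]/\mathfrak m S[It]$ (equivalently, one plus the dimension of the image of the rational map $\phi:\mathbf P^n\dashrightarrow \mathbf P^r=\mathbf P(W)$ defined by $W$). A homogeneous presentation of $I$ is a homogeneous free presentation $F\to G\to I\to 0$ with respect to a homogeneous minimal generating set of $I$; after a choice of homogeneous bases it is given by a matrix whose rows are indexed by the generators, and a row ideal is the ideal generated by the entries of one row. Then there are a basis $b_0,\dots,b_r$ of $W$ and a homogeneous presentation matrix $A$ of $I$ with respect to the minimal generators $b_0,\dots,b_r$, with finitely many columns, such that 1. each row of $A$ corresponds to the image under $\phi$ of a $k$-rational point outside the exceptional locus $V(I)$: for every $i$ there is a $k$-rational point $p\in\mathbf P^n\setminus V(I)$ for which the span of the $b_j$ with $j\neq i$ is the subspace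 $W_{\phi(p)}=\{w\in W: w(p)=0\}$ of $W$; 2. every row ideal of $A$ has codimension at most $\ell(I)-1$. -/

import Mathlib

namespace RowIdeals

/-- The homogeneous maximal ideal `(x₀, …, xₙ)` of `k[x₀, …, xₙ]`. -/
noncomputable def homogeneousMaximalIdeal (k : Type*) [Field k] (n : ℕ) :
    Ideal (MvPolynomial (Fin (n + 1)) k) :=
  Ideal.span (Set.range MvPolynomial.X)

/-- The special fiber ring `R(I) / m R(I) = ⊕ Iʲ / m Iʲ` of an ideal `I` of `k[x₀, …, xₙ]`,
where `R(I) = S[It]` is the Rees algebra and `m` the homogeneous maximal ideal. -/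
abbrev SpecialFiberRing {k : Type*} [Field k] {n : ℕ}
    (I : Ideal (MvPolynomial (Fin (n + 1)) k)) : Type _ :=
  reesAlgebra I ⧸ (homogeneousMaximalIdeal k n).map
    (algebraMap (MvPolynomial (Fin (n + 1)) k) (reesAlgebra I))

/-- The analytic spread `ℓ(I)`: the Krull dimension of the special fiber ring. -/
noncomputable def analyticSpread {k : Type*} [Field k] {n : ℕ}
    (I : Ideal (MvPolynomial (Fin (n + 1)) k)) : WithBot ℕ∞ :=
  ringKrullDim (SpecialFiberRing I)

/-- `A` is the matrix of a homogeneous free presentation `F → G → I → 0` with respect to the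
homogeneous minimal generating set `g` of `I`. Here `G` has a basis indexed by `ι`, mapped to `g`,
and `F` a basis indexed by `κ`; the columns of `A` are the images of the basis elements of `F`,
and the rows of `A` correspond to the generators. -/
structure IsHomogeneousPresentation {σ k ι κ : Type*} [Field k] [Fintype ι] [Fintype κ]
    (I : Ideal (MvPolynomial σ k)) (g : ι → MvPolynomial σ k)
    (A : Matrix ι κ (MvPolynomial σ k)) : Prop where
  /-- the `g i` generate `I` -/
  span_eq : Ideal.span (Set.range g) = I
  /-- no `g i` can be omitted -/
  minimal : ∀ i, g i ∉ Ideal.span (g '' {i}ᶜ)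
  /-- there are degrees `a i` of the basis elements of `G` and `e j` of those of `F` for which
  both maps are homogeneous of degree `0` -/
  homogeneous : ∃ (a : ι → ℕ) (e : κ → ℕ), (∀ i, (g i).IsHomogeneous (a i)) ∧
    ∀ i j, A i j = 0 ∨ ∃ c, e j = a i + c ∧ (A i j).IsHomogeneous c
  /-- the columns of `A` generate the module of syzygies of `g` -/
  exact : LinearMap.range A.mulVecLin =
    LinearMap.ker (Fintype.linearCombination (MvPolynomial σ k) g)

/-- The ideal generated by the entries of the `i`-th row of a matrix. -/
def rowIdeal {R ι κ : Type*} [CommRing R] (A : Matrix ι κ R) (i : ι) : Ideal R :=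
  Ideal.span (Set.range (A i))

/-- The set of `k`-rational points of `V(I)` in projective space, for a homogeneous ideal `I`.
If `I` is generated by a space `W` of forms of the same degree, this is the exceptional locus of
the rational map defined by `W`. (Vanishing of forms does not depend on the representative.) -/
def zeroLocus {k : Type*} [Field k] {n : ℕ} (I : Ideal (MvPolynomial (Fin (n + 1)) k)) :
    Set (Projectivization k (Fin (n + 1) → k)) :=
  {p | ∀ f ∈ I, MvPolynomial.eval p.rep f = 0}

/-- The image `φ(p)` of a point `p` under the rational map `φ` to `ℙ(W)` defined by a space `W` of
forms of the same degree. A rational point `q` of `ℙ(W)` is a subspace `W_q` of codimension `1`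
of `W`; for `φ(p)` it consists of the forms in `W` vanishing at `p`
(and it has codimension `1` exactly if `p` is outside of the exceptional locus). -/
noncomputable def imagePoint {k : Type*} [Field k] {n : ℕ}
    (W : Submodule k (MvPolynomial (Fin (n + 1)) k))
    (p : Projectivization k (Fin (n + 1) → k)) : Submodule k (MvPolynomial (Fin (n + 1)) k) :=
  W ⊓ LinearMap.ker (MvPolynomial.aeval (R := k) p.rep).toLinearMap

/-- The point of `ℙ(W)` to which the `i`-th row of a presentation matrix with respect to the basis
`b` of `W` corresponds: that row is the composition of `F → G = S ⊗ W` with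
`S ⊗ W → S ⊗ (W / W_q)`, where `W_q` is spanned by the `b j` with `j ≠ i`. -/
noncomputable def rowPoint {k : Type*} [Field k] {n : ℕ} {ι : Type*}
    {W : Submodule k (MvPolynomial (Fin (n + 1)) k)} (b : Module.Basis ι k W) (i : ι) :
    Submodule k (MvPolynomial (Fin (n + 1)) k) :=
  Submodule.span k ((fun j => (b j : MvPolynomial (Fin (n + 1)) k)) '' {i}ᶜ)

end RowIdeals

/-! Since `k` is infinite, evaluations at rational points span the dual of `W`; choose points `p i`
whose evaluations form a basis, and let `b` be the dual basis, so `b j` vanishes at `p i` exactly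
when `j ≠ i`. This gives condition 1 and the minimality of the generators. For any syzygy matrix of
`b`, a prime `Q` containing all `b j` with `j ≠ i` but not `b i` contains row ideal `i`. So it
suffices to find such a `Q` of height at most `ℓ(I) - 1`: morally, a component of the fiber of `φ`
through `p i`.

To find it, let `R = k[b₀t, …, bᵣt]` inside `S[t]`; it is a quotient of the special fiber ring, so
its dimension is at most `ℓ(I)`. The functions vanishing on the line over `p i` contract to a prime
of `R` strictly below another prime, hence of height at most `ℓ(I) - 1`. Krull's height theorem,
applied to that many elements of `R` in `S[t]`, bounds the height of a prime of `S[t]` with the same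
contraction; intersecting it with `S` gives `Q`. -/

open MvPolynomial in
/-- Homogeneous syzygies of forms of the same degree are generated by finitely many
homogeneous ones. -/
theorem exists_homogeneous_syzygy_matrix {σ k : Type*} [Field k] [Finite σ] {m d : ℕ}
    (g : Fin m → MvPolynomial σ k) (hg : ∀ i, (g i).IsHomogeneous d) :
    ∃ (s : ℕ) (A : Matrix (Fin m) (Fin s) (MvPolynomial σ k)) (e : Fin s → ℕ),
      (∀ i j, (A i j).IsHomogeneous (e j)) ∧
      LinearMap.range A.mulVecLin =
        LinearMap.ker (Fintype.linearCombination (MvPolynomial σ k) g) := by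
  classical
  let _ := MvPolynomial.gradedAlgebra (σ := σ) (R := k)
  set N := LinearMap.ker (Fintype.linearCombination (MvPolynomial σ k) g) with hN
  let H : Set (Fin m → MvPolynomial σ k) := {v | v ∈ N ∧ ∃ c, ∀ i, (v i).IsHomogeneous c}
  have hH : Submodule.span (MvPolynomial σ k) H = N := by
    apply le_antisymm
    · exact Submodule.span_le.2 fun v hv => hv.1
    · intro v hv
      let B := Finset.univ.sup fun i => (v i).totalDegree
      have hsum : v = ∑ c ∈ Finset.range (B + 1), fun i => homogeneousComponent c (v i) := by
        funext i
        rw [Finset.sum_apply]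
        conv_lhs => rw [← sum_homogeneousComponent (v i)]
        apply Finset.sum_subset
        · intro c hc
          have : (v i).totalDegree ≤ B :=
            Finset.le_sup (f := fun i => (v i).totalDegree) (Finset.mem_univ i)
          simp only [Finset.mem_range] at hc ⊢
          omega
        · intro c _ hc
          apply homogeneousComponent_eq_zero
          simp only [Finset.mem_range] at hc
          omega
      rw [hsum]
      refine Submodule.sum_mem _ fun c _ => Submodule.subset_span ⟨?_, c, fun i =>
        homogeneousComponent_isHomogeneous c (v i)⟩
      rw [hN, LinearMap.mem_ker, Fintype.linearCombination_apply] at hv ⊢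
      -- All `g i` have the same degree `d`, so multiplying by them shifts components uniformly;
      -- hence each graded piece of a syzygy is again a syzygy.
      have key : ∀ i, homogeneousComponent c (v i) • g i =
          homogeneousComponent (c + d) (v i • g i) := by
        intro i
        have := DirectSum.coe_decompose_mul_add_of_right_mem (homogeneousSubmodule σ k)
          (i := c) (a := v i) (hg i)
        have hdec : ∀ (φ : MvPolynomial σ k) (a : ℕ),
            (DirectSum.decompose (homogeneousSubmodule σ k) φ a : MvPolynomial σ k) =
              homogeneousComponent a φ := decomposition.decompose'_apply
        rw [hdec, hdec] at this
        rw [smul_eq_mul, smul_eq_mul, this]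
      rw [Finset.sum_congr rfl fun i _ => key i, ← map_sum, hv, map_zero]
  obtain ⟨t, htH, ht⟩ := (Submodule.fg_span_iff_fg_span_finset_subset H).1
    (IsNoetherian.noetherian (Submodule.span (MvPolynomial σ k) H))
  let w : Fin t.card → Fin m → MvPolynomial σ k := fun j => (t.equivFin.symm j : _)
  have hw : ∀ j, w j ∈ H := fun j => htH (t.equivFin.symm j).2
  choose hwN e he using hw
  refine ⟨t.card, Matrix.of fun i j => w j i, e, fun i j => he j i, ?_⟩
  rw [Matrix.range_mulVecLin, ← hH, ht]
  congr 1
  ext v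
  constructor
  · rintro ⟨j, rfl⟩
    exact (t.equivFin.symm j).2
  · intro hv
    refine ⟨t.equivFin ⟨v, hv⟩, ?_⟩
    funext i
    simp [w, Matrix.col_apply]

/-! ### Heights of primes and Krull dimension under ring maps -/

/-- A prime ideal `P` of a Noetherian ring contains a prime ideal with the same contraction along
`f`, whose height is at most the height of that contraction. -/
theorem exists_isPrime_comap_eq_height_le {R S : Type*} [CommRing R] [CommRing S]
    [IsNoetherianRing R] [IsNoetherianRing S] (f : R →+* S) (P : Ideal S) [P.IsPrime] :
    ∃ Q : Ideal S, Q.IsPrime ∧ Q ≤ P ∧ Q.comap f = P.comap f ∧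
      Q.height ≤ (P.comap f).height := by
  classical
  -- The contraction of `P` is minimal over as many elements as its height. A prime below `P` that
  -- is minimal over their images has the same contraction by this minimality, and its height is
  -- bounded by Krull's theorem.
  obtain ⟨s, hs, hcard⟩ := (P.comap f).exists_finset_card_eq_height_of_isNoetherianRing
  have hle : Ideal.span ((s.image f : Finset S) : Set S) ≤ P := by
    rw [Ideal.span_le, Finset.coe_image, Set.image_subset_iff]
    exact fun x hx => hs.1.2 (Ideal.subset_span hx)
  obtain ⟨Q, hQ, hQP⟩ := Ideal.exists_minimalPrimes_le hle
  have hQprime : Q.IsPrime := hQ.1.1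
  refine ⟨Q, hQprime, hQP, le_antisymm (Ideal.comap_mono hQP) ?_, ?_⟩
  · refine hs.2 ⟨inferInstance, ?_⟩ (Ideal.comap_mono hQP)
    rw [Ideal.span_le]
    exact fun x hx => hQ.1.2 (Ideal.subset_span (by simpa using ⟨x, hx, rfl⟩))
  · rw [← hcard]
    exact (Ideal.height_le_card_of_mem_minimalPrimes_span_finset hQ).trans
      (by exact_mod_cast Finset.card_image_le)

theorem ringKrullDim_le_of_ker_le {A B C : Type*} [CommRing A] [CommRing B] [CommRing C]
    (f : A →+* B) (g : A →+* C) (hf : Function.Surjective f) (hg : Function.Surjective g)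
    (h : RingHom.ker f ≤ RingHom.ker g) : ringKrullDim C ≤ ringKrullDim B := by
  refine ringKrullDim_le_of_surjective (f.liftOfSurjective hf ⟨g, h⟩) fun c => ?_
  obtain ⟨a, rfl⟩ := hg c
  exact ⟨f a, f.liftOfRightInverse_comp_apply _ _ ⟨g, h⟩ a⟩

/-- Going down holds for `R → R[X]`, so heights add along the fiber. -/
theorem height_comap_C_le {R : Type*} [CommRing R] [IsNoetherianRing R]
    (Q : Ideal (Polynomial R)) [Q.IsPrime] : (Q.comap Polynomial.C).height ≤ Q.height := by
  have : Q.LiesOver (Q.comap Polynomial.C) := ⟨rfl⟩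
  rw [Ideal.height_eq_height_add_of_liesOver_of_hasGoingDown (Q.comap Polynomial.C) Q]
  exact le_self_add

/-! ### Forms and powers of the ideal of the variables -/

theorem MvPolynomial.IsHomogeneous.degree_eq_of_mem_support {σ k : Type*} [CommSemiring k]
    {f : MvPolynomial σ k} {N : ℕ} (hf : f.IsHomogeneous N) {x : σ →₀ ℕ} (hx : x ∈ f.support) :
    x.degree = N := by
  by_contra h
  exact MvPolynomial.mem_support_iff.1 hx (hf.coeff_eq_zero h)

theorem MvPolynomial.IsHomogeneous.mem_pow_idealOfVars {σ k : Type*} [CommSemiring k]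
    {f : MvPolynomial σ k} {N : ℕ} (hf : f.IsHomogeneous N) :
    f ∈ MvPolynomial.idealOfVars σ k ^ N := by
  rw [MvPolynomial.mem_pow_idealOfVars_iff]
  intro x hx
  exact (hf.degree_eq_of_mem_support hx).ge

theorem MvPolynomial.IsHomogeneous.eq_zero_of_mem_pow_idealOfVars {σ k : Type*} [CommSemiring k]
    {f : MvPolynomial σ k} {N : ℕ} (hf : f.IsHomogeneous N)
    (h : f ∈ MvPolynomial.idealOfVars σ k ^ (N + 1)) : f = 0 := by
  rw [MvPolynomial.mem_pow_idealOfVars_iff] at h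
  by_contra hne
  obtain ⟨x, hx⟩ := MvPolynomial.support_nonempty.2 hne
  have := h x hx
  have := hf.degree_eq_of_mem_support hx
  omega

namespace RowIdeals

open Polynomial (C X)

section

variable {k : Type*} [Field k] {n m : ℕ}

/-! ### The special fiber ring and the algebra generated by the `gᵢ t` -/

/-- The parametrization `yᵢ ↦ gᵢ t` of the special fiber by the generators `g`. -/
noncomputable def genHom (g : Fin m → MvPolynomial (Fin (n + 1)) k) :
    MvPolynomial (Fin m) k →ₐ[k] Polynomial (MvPolynomial (Fin (n + 1)) k) :=
  MvPolynomial.aeval fun i => C (g i) * X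

/-- `genHom` with values in the Rees algebra. -/
noncomputable def genHomRees (g : Fin m → MvPolynomial (Fin (n + 1)) k) :
    MvPolynomial (Fin m) k →ₐ[k] reesAlgebra (Ideal.span (Set.range g)) :=
  MvPolynomial.aeval fun i => ⟨C (g i) * X, by
    rw [Polynomial.C_mul_X_eq_monomial, reesAlgebra.monomial_mem, pow_one]
    exact Ideal.subset_span ⟨i, rfl⟩⟩

theorem coe_genHomRees (g : Fin m → MvPolynomial (Fin (n + 1)) k) (f : MvPolynomial (Fin m) k) :
    (genHomRees g f : Polynomial (MvPolynomial (Fin (n + 1)) k)) = genHom g f := by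
  induction f using MvPolynomial.induction_on with
  | C a => simp [genHomRees, genHom]
  | add p q hp hq => rw [map_add, map_add, ← hp, ← hq]; rfl
  | mul_X p i hp =>
    rw [map_mul, map_mul, ← hp]
    simp [genHomRees, genHom]

theorem isHomogeneous_coeff_genHom {d : ℕ} (g : Fin m → MvPolynomial (Fin (n + 1)) k)
    (hg : ∀ i, (g i).IsHomogeneous d) (f : MvPolynomial (Fin m) k) (j : ℕ) :
    ((genHom g f).coeff j).IsHomogeneous (d * j) := by
  induction f using MvPolynomial.induction_on generalizing j with
  | C a =>
    have : genHom g (MvPolynomial.C a) = C (MvPolynomial.C a) := by simp [genHom]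
    rw [this, Polynomial.coeff_C]
    split_ifs with h
    · subst h
      exact MvPolynomial.isHomogeneous_C _ _
    · exact MvPolynomial.isHomogeneous_zero _ _ _
  | add p q hp hq =>
    rw [map_add, Polynomial.coeff_add]
    exact (hp j).add (hq j)
  | mul_X p i hp =>
    have : genHom g (p * MvPolynomial.X i) = genHom g p * C (g i) * X := by
      simp [genHom, mul_assoc]
    rw [this]
    cases j with
    | zero => simpa using MvPolynomial.isHomogeneous_zero _ _ _
    | succ j =>
      rw [Polynomial.coeff_mul_X, Polynomial.coeff_mul_C]
      exact (hp j).mul (hg i)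

/-- The coefficient of `tʲ` in the Rees algebra lies in `Iʲ`, hence in `m ^ (d * j)`; a factor from
`m` adds one to the exponent. -/
theorem coeff_mem_of_mem_map_homogeneousMaximalIdeal {d : ℕ}
    {I : Ideal (MvPolynomial (Fin (n + 1)) k)}
    (hI : I ≤ homogeneousMaximalIdeal k n ^ d) {x : reesAlgebra I}
    (hx : x ∈ (homogeneousMaximalIdeal k n).map
      (algebraMap (MvPolynomial (Fin (n + 1)) k) (reesAlgebra I))) (j : ℕ) :
    (x : Polynomial (MvPolynomial (Fin (n + 1)) k)).coeff j ∈
      homogeneousMaximalIdeal k n ^ (d * j + 1) := by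
  rw [Ideal.map] at hx
  induction hx using Submodule.span_induction generalizing j with
  | mem x hx =>
    obtain ⟨s, hs, rfl⟩ := hx
    have : ((algebraMap (MvPolynomial (Fin (n + 1)) k) (reesAlgebra I) s : reesAlgebra I) :
        Polynomial (MvPolynomial (Fin (n + 1)) k)) = C s := rfl
    rw [this, Polynomial.coeff_C]
    split_ifs with h
    · subst h
      simpa using hs
    · exact Ideal.zero_mem _
  | zero => simp
  | add x y _ _ hx hy =>
    rw [Subalgebra.coe_add, Polynomial.coeff_add]
    exact Ideal.add_mem _ (hx j) (hy j)
  | smul a x _ hx =>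
    rw [smul_eq_mul, Subalgebra.coe_mul, Polynomial.coeff_mul]
    refine Ideal.sum_mem _ fun ⟨p, q⟩ hpq => ?_
    rw [← Finset.HasAntidiagonal.mem_antidiagonal.1 hpq, mul_add, add_assoc, pow_add]
    refine Ideal.mul_mem_mul ?_ (hx q)
    rw [pow_mul]
    exact Ideal.pow_right_mono hI p (a.2 p)

/-- The coefficient of `tʲ` is a form of degree `d * j`, yet it lies in `m ^ (d * j + 1)`, so it
vanishes. -/
theorem genHom_eq_zero_of_genHomRees_mem {d : ℕ} (g : Fin m → MvPolynomial (Fin (n + 1)) k)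
    (hg : ∀ i, (g i).IsHomogeneous d) {f : MvPolynomial (Fin m) k}
    (hf : genHomRees g f ∈ (homogeneousMaximalIdeal k n).map
      (algebraMap (MvPolynomial (Fin (n + 1)) k) (reesAlgebra (Ideal.span (Set.range g))))) :
    genHom g f = 0 := by
  ext1 j
  rw [Polynomial.coeff_zero]
  refine (isHomogeneous_coeff_genHom g hg f j).eq_zero_of_mem_pow_idealOfVars ?_
  rw [← coe_genHomRees]
  refine coeff_mem_of_mem_map_homogeneousMaximalIdeal ?_ hf j
  rw [Ideal.span_le]
  rintro _ ⟨i, rfl⟩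
  exact (hg i).mem_pow_idealOfVars

theorem sub_C_mem_homogeneousMaximalIdeal (s : MvPolynomial (Fin (n + 1)) k) :
    s - MvPolynomial.C (s.coeff 0) ∈ homogeneousMaximalIdeal k n := by
  have := (MvPolynomial.mem_pow_idealOfVars_iff' 1 (s - MvPolynomial.C (s.coeff 0))).2
    fun x hx => by
      have : x = 0 := by
        rwa [Nat.lt_one_iff, Finsupp.degree_eq_zero_iff] at hx
      subst this
      simp
  rwa [pow_one] at this

/-- A subring of a quotient of the Rees algebra is everything if it contains the images of the base
ring and of the generators `g i t`. -/
theorem surjective_of_generators_mem_range {S T : Type*} {ι : Type*} [CommRing S] [CommRing T]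
    {g : ι → S} (K : Ideal (reesAlgebra (Ideal.span (Set.range g))))
    (ψ : T →+* reesAlgebra (Ideal.span (Set.range g)) ⧸ K)
    (hS : ∀ s, Ideal.Quotient.mk K (algebraMap S _ s) ∈ ψ.range)
    (hg : ∀ i, Ideal.Quotient.mk K ⟨Polynomial.monomial 1 (g i),
      reesAlgebra.monomial_mem.2 (by
        rw [pow_one]; exact Ideal.subset_span ⟨i, rfl⟩)⟩ ∈ ψ.range) :
    Function.Surjective ψ := by
  have hI : ∀ f (hf : f ∈ Ideal.span (Set.range g)), Ideal.Quotient.mk K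
      ⟨Polynomial.monomial 1 f, reesAlgebra.monomial_mem.2 (by rwa [pow_one])⟩ ∈ ψ.range := by
    intro f hf
    induction hf using Submodule.span_induction with
    | mem x hx =>
      obtain ⟨i, rfl⟩ := hx
      exact hg i
    | zero =>
      convert ψ.range.zero_mem
      rw [← map_zero (Ideal.Quotient.mk K)]
      congr 1
      apply Subtype.ext
      simp
    | add x y _ _ hx hy =>
      convert ψ.range.add_mem hx hy
      rw [← map_add]
      congr 1
      apply Subtype.ext
      simp
    | smul a x _ hx =>
      convert ψ.range.mul_mem (hS a) hx
      rw [← map_mul]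
      congr 1
      apply Subtype.ext
      change _ = C a * _
      simp [Polynomial.C_mul_monomial]
  have hall : ∀ x (hx : x ∈ Algebra.adjoin S (Submodule.map
      (Polynomial.monomial 1 : S →ₗ[S] Polynomial S) (Ideal.span (Set.range g)) :
        Set (Polynomial S))),
      Ideal.Quotient.mk K ⟨x, adjoin_monomial_eq_reesAlgebra (Ideal.span (Set.range g)) ▸ hx⟩ ∈
        ψ.range := by
    intro x hx
    induction hx using Algebra.adjoin_induction with
    | mem x hx =>
      obtain ⟨f, hf, rfl⟩ := hx
      exact hI f hf
    | algebraMap s => exact hS s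
    | add x y _ _ hx hy => exact ψ.range.add_mem hx hy
    | mul x y _ _ hx hy => exact ψ.range.mul_mem hx hy
  intro y
  obtain ⟨⟨x, hx⟩, rfl⟩ := Ideal.Quotient.mk_surjective y
  exact hall x (by rw [adjoin_monomial_eq_reesAlgebra]; exact hx)

/-- The special fiber ring is generated over `k` by the classes of the `g i t`. -/
theorem mk_comp_genHomRees_surjective (g : Fin m → MvPolynomial (Fin (n + 1)) k) :
    Function.Surjective ((Ideal.Quotient.mk ((homogeneousMaximalIdeal k n).map
      (algebraMap (MvPolynomial (Fin (n + 1)) k) (reesAlgebra (Ideal.span (Set.range g)))))).comp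
        (genHomRees g : MvPolynomial (Fin m) k →+* _)) := by
  refine surjective_of_generators_mem_range _ _ (fun s => ?_) fun i => ?_
  -- Modulo `m`, a polynomial equals its constant term.
  · refine ⟨MvPolynomial.C (s.coeff 0), ?_⟩
    rw [RingHom.comp_apply, eq_comm, Ideal.Quotient.eq]
    have h := Ideal.mem_map_of_mem
      (algebraMap (MvPolynomial (Fin (n + 1)) k) (reesAlgebra (Ideal.span (Set.range g))))
      (sub_C_mem_homogeneousMaximalIdeal s)
    rw [map_sub] at h
    convert h using 2
    exact (genHomRees g).commutes _
  · refine ⟨MvPolynomial.X i, ?_⟩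
    rw [RingHom.comp_apply]
    congr 1
    apply Subtype.ext
    change (genHomRees g (MvPolynomial.X i) : Polynomial (MvPolynomial (Fin (n + 1)) k)) = _
    rw [coe_genHomRees]
    simp [genHom, Polynomial.C_mul_X_eq_monomial]

/-- Relations among the `gᵢ t` modulo `m` are already relations in `S[t]`, so the special fiber ring
surjects onto the image of `genHom`. -/
theorem ringKrullDim_range_genHom_le_analyticSpread {d : ℕ}
    (g : Fin m → MvPolynomial (Fin (n + 1)) k) (hg : ∀ i, (g i).IsHomogeneous d) :
    ringKrullDim (genHom g).toRingHom.range ≤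
      analyticSpread (Ideal.span (Set.range g)) := by
  refine ringKrullDim_le_of_ker_le (B := SpecialFiberRing (Ideal.span (Set.range g)))
    ((Ideal.Quotient.mk _).comp (genHomRees g : MvPolynomial (Fin m) k →+* _))
    (genHom g).toRingHom.rangeRestrict
    (mk_comp_genHomRees_surjective g) (RingHom.rangeRestrict_surjective _) fun f hf => ?_
  rw [RingHom.mem_ker, RingHom.comp_apply, Ideal.Quotient.eq_zero_iff_mem] at hf
  exact Subtype.ext (genHom_eq_zero_of_genHomRees_mem g hg hf)

/-! ### Codimension of fibers -/

/-- Every fiber of the map defined by `g` has a component of codimension at most `ℓ(I) - 1`: if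
`v` is a point where only `g i` does not vanish, then some prime containing all the other `g j`,
but not `g i`, has height at most `ℓ(I) - 1`. -/
theorem exists_isPrime_height_add_one_le_analyticSpread {d : ℕ}
    (g : Fin m → MvPolynomial (Fin (n + 1)) k) (hg : ∀ i, (g i).IsHomogeneous d)
    (v : Fin (n + 1) → k) (i : Fin m) (hi : MvPolynomial.eval v (g i) ≠ 0)
    (hv : ∀ j, j ≠ i → MvPolynomial.eval v (g j) = 0) :
    ∃ Q : Ideal (MvPolynomial (Fin (n + 1)) k), Q.IsPrime ∧ g i ∉ Q ∧ (∀ j, j ≠ i → g j ∈ Q) ∧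
      (Q.height : WithBot ℕ∞) + 1 ≤ analyticSpread (Ideal.span (Set.range g)) := by
  let ev : Polynomial (MvPolynomial (Fin (n + 1)) k) →+* Polynomial k :=
    Polynomial.mapRingHom (MvPolynomial.eval v)
  let ev₀ : Polynomial (MvPolynomial (Fin (n + 1)) k) →+* k := (Polynomial.evalRingHom 0).comp ev
  have hev : ∀ j, ev (C (g j) * X) = C (MvPolynomial.eval v (g j)) * X := by
    intro j; simp [ev]
  let R := (genHom g).toRingHom.range
  let y : Fin m → R := fun j => ⟨C (g j) * X, MvPolynomial.X j, by simp [genHom]⟩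
  have : IsNoetherianRing R :=
    isNoetherianRing_of_surjective _ _ (genHom g).toRingHom.rangeRestrict
      (RingHom.rangeRestrict_surjective _)
  let ι : R →+* Polynomial (MvPolynomial (Fin (n + 1)) k) := R.subtype
  have : (RingHom.ker ev).IsPrime := RingHom.ker_isPrime ev
  have : (RingHom.ker ev₀).IsPrime := RingHom.ker_isPrime ev₀
  -- `ev` restricts to the line over `v`, and `ev₀` to its point `t = 0`. The element `gᵢ t`
  -- vanishes at that point but not on the line; this strict inclusion supplies the `-1` in the
  -- bound.
  have hlt : (RingHom.ker ev).comap ι < (RingHom.ker ev₀).comap ι := by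
    refine lt_of_le_of_ne (Ideal.comap_mono fun x hx => ?_) fun h => ?_
    · rw [RingHom.mem_ker] at hx ⊢
      rw [RingHom.comp_apply, hx, map_zero]
    · have h₀ : y i ∈ (RingHom.ker ev₀).comap ι := by
        change ev₀ (C (g i) * X) = 0
        rw [RingHom.comp_apply, hev]
        simp
      rw [← h] at h₀
      have h₁ : ev (C (g i) * X) = 0 := h₀
      rw [hev] at h₁
      simp [hi] at h₁
  obtain ⟨Q, hQ, hQP, hcomap, hheight⟩ := exists_isPrime_comap_eq_height_le ι (RingHom.ker ev)
  refine ⟨Q.comap C, inferInstance, fun h => hi ?_, fun j hj => ?_, ?_⟩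
  · have : ev (C (g i)) = 0 := hQP h
    simpa [ev] using this
  · have h₁ : y j ∈ Q.comap ι := by
      rw [hcomap]
      change ev (C (g j) * X) = 0
      rw [hev, hv j hj]
      simp
    -- `Q` contains `gⱼ t` but not `t`, because `Q ≤ ker ev` and `ev` fixes `t`.
    refine (hQ.mem_or_mem (show C (g j) * X ∈ Q from h₁)).resolve_right fun hX => ?_
    have : ev X = 0 := hQP hX
    simp [ev] at this
  · refine le_trans ?_ (ringKrullDim_range_genHom_le_analyticSpread g hg)
    refine le_trans ?_ (Ideal.height_le_ringKrullDim_of_isPrime (I := (RingHom.ker ev₀).comap ι))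
    have := Ideal.height_add_one_le_of_lt_of_isPrime hlt
    have h₂ : (Q.comap C).height + 1 ≤ ((RingHom.ker ev₀).comap ι).height :=
      (add_le_add_left ((height_comap_C_le Q).trans hheight) 1).trans this
    exact_mod_cast h₂

/-! ### Bases of `W` dual to rational points -/

theorem eq_zero_of_forall_eval_rep_eq_zero [Infinite k] {f : MvPolynomial (Fin (n + 1)) k}
    (h : ∀ p : Projectivization k (Fin (n + 1) → k), MvPolynomial.eval p.rep f = 0) {d : ℕ}
    (hf : f.IsHomogeneous d) : f = 0 := by
  -- The origin represents no projective point; the factor `X 0` makes the product vanish there too.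
  have hx : MvPolynomial.X (0 : Fin (n + 1)) * f = 0 := by
    apply MvPolynomial.funext
    intro v
    by_cases hv : v = 0
    · simp [hv]
    · obtain ⟨a, ha⟩ := Projectivization.exists_smul_eq_mk_rep k v hv
      have := h (Projectivization.mk k v hv)
      rw [← ha] at this
      have h₂ : MvPolynomial.eval (a • v) f = (a : k) ^ d * MvPolynomial.eval v f := by
        rw [MvPolynomial.eval_eq, MvPolynomial.eval_eq, Finset.mul_sum]
        refine Finset.sum_congr rfl fun x hx => ?_
        have hdeg : ∑ i ∈ x.support, x i = d := hf.degree_eq_of_mem_support hx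
        simp only [Pi.smul_apply, Units.smul_def, smul_eq_mul, mul_pow, Finset.prod_mul_distrib,
          Finset.prod_pow_eq_pow_sum, hdeg]
        ring
      rw [h₂] at this
      have : MvPolynomial.eval v f = 0 := by simpa using this
      simp [this]
  exact (mul_eq_zero.1 hx).resolve_left (MvPolynomial.X_ne_zero _)

/-- A space of forms of degree `d` has a basis which is dual to the evaluations at suitable
points. -/
theorem exists_basis_dual_to_points [Infinite k] {r d : ℕ}
    (W : Submodule k (MvPolynomial (Fin (n + 1)) k))
    (hWd : W ≤ MvPolynomial.homogeneousSubmodule (Fin (n + 1)) k d)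
    (hWr : Module.finrank k W = r + 1) :
    ∃ (b : Module.Basis (Fin (r + 1)) k W)
      (p : Fin (r + 1) → Projectivization k (Fin (n + 1) → k)),
      ∀ i j, MvPolynomial.eval (p i).rep (b j : MvPolynomial (Fin (n + 1)) k) =
        if i = j then 1 else 0 := by
  have : FiniteDimensional k W := Module.finite_of_finrank_pos (by omega)
  let ev : Projectivization k (Fin (n + 1) → k) → Module.Dual k W := fun p =>
    (MvPolynomial.aeval (R := k) p.rep).toLinearMap.comp W.subtype
  -- A form in `W` killed by all evaluations is zero, so in finite dimension the evaluations span
  -- the dual.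
  have hspan : Submodule.span k (Set.range ev) = ⊤ := by
    rw [← Subspace.dualCoannihilator_dualAnnihilator_eq (W := Submodule.span k (Set.range ev))]
    have : (Submodule.span k (Set.range ev)).dualCoannihilator = ⊥ := by
      rw [eq_bot_iff]
      intro f hf
      rw [Submodule.mem_dualCoannihilator] at hf
      refine Subtype.ext (eq_zero_of_forall_eval_rep_eq_zero (fun p => ?_) (hWd f.2))
      exact hf (ev p) (Submodule.subset_span ⟨p, rfl⟩)
    rw [this, Submodule.dualAnnihilator_bot]
  obtain ⟨t, htr, hts, hti⟩ := exists_linearIndependent k (Set.range ev)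
  let c₀ : Module.Basis t k (Module.Dual k W) := Module.Basis.mk hti (by simp [hts, hspan])
  let c := c₀.reindex (c₀.indexEquiv (Module.finBasisOfFinrankEq k (Module.Dual k W)
    (Subspace.dual_finrank_eq.trans hWr)))
  have hc : ∀ i, ∃ p, ev p = c i := fun i => by
    simp only [c, c₀, Module.Basis.reindex_apply, Module.Basis.mk_apply]
    exact htr (Subtype.prop _)
  choose p hp using hc
  refine ⟨c.dualBasis.map (Module.evalEquiv k W).symm, p, fun i j => ?_⟩
  have h₁ : ev (p i) (c.dualBasis.map (Module.evalEquiv k W).symm j) = c.dualBasis j (c i) := by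
    rw [hp, Module.Basis.map_apply, Module.apply_evalEquiv_symm_apply]
  rw [Module.Basis.dualBasis_apply_self] at h₁
  exact h₁

theorem rowPoint_eq_imagePoint {r : ℕ} {W : Submodule k (MvPolynomial (Fin (n + 1)) k)}
    (b : Module.Basis (Fin (r + 1)) k W) (p : Projectivization k (Fin (n + 1) → k))
    (i : Fin (r + 1))
    (hb : ∀ j, MvPolynomial.eval p.rep (b j : MvPolynomial (Fin (n + 1)) k) =
      if i = j then 1 else 0) :
    rowPoint b i = imagePoint W p := by
  apply le_antisymm
  · rw [rowPoint, Submodule.span_le]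
    rintro _ ⟨j, hj, rfl⟩
    exact ⟨(b j).2, (hb j).trans (if_neg fun h => hj h.symm)⟩
  · rintro f ⟨hfW, hf⟩
    have hsum := congrArg W.subtype (b.sum_repr ⟨f, hfW⟩)
    rw [map_sum] at hsum
    simp only [map_smul, Submodule.subtype_apply] at hsum
    have hf' : MvPolynomial.eval p.rep f = 0 := hf
    rw [← hsum, map_sum] at hf'
    simp only [MvPolynomial.smul_eval, hb, mul_ite, mul_one, mul_zero, Finset.sum_ite_eq,
      Finset.mem_univ, if_true] at hf'
    rw [← hsum]
    refine Submodule.sum_mem _ fun j _ => ?_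
    by_cases hj : j = i
    · rw [hj, hf', zero_smul]
      exact Submodule.zero_mem _
    · exact Submodule.smul_mem _ _ (Submodule.subset_span ⟨j, hj, rfl⟩)

/-! ### Row ideals and the main theorem -/

/-- A row ideal is contained in each prime that contains all generators but the one of the row. -/
theorem rowIdeal_le_of_isPrime {R ι κ : Type*} [CommRing R] [Fintype ι] [Fintype κ]
    {g : ι → R} {A : Matrix ι κ R}
    (hA : LinearMap.range A.mulVecLin ≤ LinearMap.ker (Fintype.linearCombination R g))
    {Q : Ideal R} [Q.IsPrime] {i : ι} (hi : g i ∉ Q) (hQ : ∀ j, j ≠ i → g j ∈ Q) :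
    rowIdeal A i ≤ Q := by
  classical
  rw [rowIdeal, Ideal.span_le]
  rintro _ ⟨l, rfl⟩
  -- Column `l` is a syzygy, so modulo `Q` only the term `A i l * g i` survives.
  have h := hA ⟨Pi.single l 1, rfl⟩
  rw [LinearMap.mem_ker, Fintype.linearCombination_apply] at h
  simp only [Matrix.mulVecLin_apply, Matrix.mulVec_single_one, Matrix.col_apply, smul_eq_mul] at h
  rw [← Finset.add_sum_erase _ _ (Finset.mem_univ i)] at h
  have : A i l * g i ∈ Q := by
    rw [eq_neg_of_add_eq_zero_left h]
    exact Q.neg_mem (Ideal.sum_mem _ fun j hj =>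
      Q.mul_mem_left _ (hQ j (Finset.ne_of_mem_erase hj)))
  exact (‹Q.IsPrime›.mem_or_mem this).resolve_right hi

end

end RowIdeals

theorem mainTheorem8 {k : Type*} [Field k] [Infinite k] (n r d : ℕ)
    (W : Submodule k (MvPolynomial (Fin (n + 1)) k))
    (hWd : W ≤ MvPolynomial.homogeneousSubmodule (Fin (n + 1)) k d)
    (hWr : Module.finrank k W = r + 1)
    (I : Ideal (MvPolynomial (Fin (n + 1)) k))
    (hI : I = Ideal.span (W : Set (MvPolynomial (Fin (n + 1)) k)))
    (hcodim : 2 ≤ I.height) :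
    ∃ (b : Module.Basis (Fin (r + 1)) k W) (s : ℕ)
      (A : Matrix (Fin (r + 1)) (Fin s) (MvPolynomial (Fin (n + 1)) k)),
      RowIdeals.IsHomogeneousPresentation I
        (fun i => (b i : MvPolynomial (Fin (n + 1)) k)) A ∧
      (∀ i, ∃ p : Projectivization k (Fin (n + 1) → k),
        p ∉ RowIdeals.zeroLocus I ∧ RowIdeals.rowPoint b i = RowIdeals.imagePoint W p) ∧
      ∀ i, ((RowIdeals.rowIdeal A i).height : WithBot ℕ∞) + 1 ≤ RowIdeals.analyticSpread I := by
  obtain ⟨b, p, hbp⟩ := RowIdeals.exists_basis_dual_to_points W hWd hWr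
  have hhom : ∀ i, (b i : MvPolynomial (Fin (n + 1)) k).IsHomogeneous d := fun i => hWd (b i).2
  obtain ⟨s, A, e, hAe, hA⟩ := exists_homogeneous_syzygy_matrix
    (fun i => (b i : MvPolynomial (Fin (n + 1)) k)) hhom
  have hspan : Ideal.span (Set.range fun i => (b i : MvPolynomial (Fin (n + 1)) k)) = I := by
    rw [hI]
    apply le_antisymm
    · exact Ideal.span_mono (by rintro _ ⟨i, rfl⟩; exact (b i).2)
    · rw [Ideal.span_le]
      intro f hf
      have hsum := congrArg W.subtype (b.sum_repr ⟨f, hf⟩)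
      rw [map_sum] at hsum
      simp only [map_smul, Submodule.subtype_apply] at hsum
      rw [← hsum]
      refine Ideal.sum_mem _ fun j _ => ?_
      rw [MvPolynomial.smul_eq_C_mul]
      exact Ideal.mul_mem_left _ _ (Ideal.subset_span ⟨j, rfl⟩)
  refine ⟨b, s, A, ⟨hspan, fun i hi => ?_, ⟨fun _ => d, fun j => d + e j, hhom, fun i j =>
    Or.inr ⟨e j, rfl, hAe i j⟩⟩, hA⟩, fun i => ⟨p i, fun h => ?_,
    RowIdeals.rowPoint_eq_imagePoint b (p i) i (hbp i)⟩, fun i => ?_⟩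
  -- Minimality: the other generators all vanish at `p i`, while `b i` takes the value `1` there.
  · have hle : Ideal.span ((fun i => (b i : MvPolynomial (Fin (n + 1)) k)) '' {i}ᶜ) ≤
        RingHom.ker (MvPolynomial.eval (p i).rep) := by
      rw [Ideal.span_le]
      rintro _ ⟨j, hj, rfl⟩
      exact (hbp i j).trans (if_neg fun h => hj h.symm)
    have := hle hi
    rw [RingHom.mem_ker, hbp i i, if_pos rfl] at this
    exact one_ne_zero this
  · have := h (b i) (hI ▸ Ideal.subset_span (b i).2)
    rw [hbp i i, if_pos rfl] at this
    exact one_ne_zero this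
  · obtain ⟨Q, hQ, hiQ, hjQ, hheight⟩ :=
      RowIdeals.exists_isPrime_height_add_one_le_analyticSpread
        (fun i => (b i : MvPolynomial (Fin (n + 1)) k)) hhom (p i).rep i
        (by simp [hbp i i]) (fun j hj => (hbp i j).trans (if_neg fun h => hj h.symm))
    rw [hspan] at hheight
    refine le_trans ?_ hheight
    have := Ideal.height_mono (RowIdeals.rowIdeal_le_of_isPrime hA.le hiQ hjQ)
    exact add_le_add_left (by exact_mod_cast this) 1
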